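/- Let $p\in\mathbb N$ and $\alpha\in[0,1)$. Consider probability distributions $P$ of $(X,Y(1),Y(0),T)$ on $\mathbb R^p\times\mathbb R\times\mathbb R\times\{0,1\}$, and put $\Delta=Y(1)-Y(0)$ and $Y=TY(1)+(1-T)Y(0)$. Fix one of the two usual meanings of "continuous" for a law on $\mathbb R$: absolutely continuous with respect to Lebesgue measure, or without atoms. (The theorem holds for each of them.) Let $\mathcal E$ be the class of all $P$ such that at least one coordinate of $X$ has a law that is absolutely continuous with respect to Lebesgue measure on $\mathbb R$, and the laws of $Y(1)$ and of $Y(0)$ are continuous. Let $$\mathcal P_{\mathrm{SI}}=\{P\in\mathcal E:(Y(1),Y(0))\perp T\mid X\},$$ and, with $e_P(X)=P(T=1\mid X)$, $$\mathcal P_{\mathrm{SI}}^{\mathrm{str}}=\{P\in\mathcal P_{\mathrm{SI}}: e_P(X)\in[c_P,1-c_P]\ \text{a.s. for some } c_P>0\}.$$ For each $n$ let $\widehat C_n$ be a (possibly randomized) prediction set: a map that assigns to the observed data $\mathcal O_n=\{(X_i,Y_i,T_i)\}_{i=1}^n$, a random seed $U_n$ with a fixed law on a measurable space, and a point $x\in\mathbb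 R^p$, a set $\widehat C_n(x)\subseteq\mathbb R$, such that $\mathbf 1\{y\in\widehat C_n(x)\}$ is jointly measurable in $(\mathcal O_n,U_n,x,y)$. Write $\mathbb P_P$ and $\mathbb E_P$ for probability and expectation when $(X_i,Y_i(1),Y_i(0),T_i)$, $i=1,\dots,n$, and a new unit $(X,Y(1),Y(0),T)$ are i.i.d. from $P$ and $U_n$ is independent of all of them. Suppose that $$\limsup_{n\to\infty}\ \sup_{P\in\mathcal P_{\mathrm{SI}}^{\mathrm{str}}}\mathbb P_P\bigl(\Delta\notin\widehat C_n(X)\bigr)\le\alpha .$$ Then for every $P\in\mathcal P_{\mathrm{SI}}$ and every $y\in\mathbb R$, $$\limsup_{n\to\infty}\mathbb P_P\bigl(y\notin\widehat C_n(X)\bigr)\le\alpha ,$$ and for every $P\in\mathcal P_{\mathrm{SI}}$, $$\lim_{n\to\infty}\mathbb E_P\bigl[\mathrm{length}(\widehat C_n(X))\bigr]=\infty ,$$ where length is Lebesgue measure and the expectation takes values in $[0,\infty]$. -/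

import Mathlib

open MeasureTheory ProbabilityTheory Filter Topology

namespace ITE

/-- Full data of one unit: `(X, Y(1), Y(0), T)` with `X ∈ ℝ^p` and binary treatment `T`
(`true` = treated, `false` = control). -/
abbrev FullData (p : ℕ) : Type := (Fin p → ℝ) × ℝ × ℝ × Bool

/-- Observed data of one unit: `(X, Y, T)`. -/
abbrev ObsData (p : ℕ) : Type := (Fin p → ℝ) × ℝ × Bool

/-- The covariate vector `X`. -/
def covariate {p : ℕ} (d : FullData p) : Fin p → ℝ := d.1

/-- The potential outcome `Y(1)`. -/
def outcome1 {p : ℕ} (d : FullData p) : ℝ := d.2.1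

/-- The potential outcome `Y(0)`. -/
def outcome0 {p : ℕ} (d : FullData p) : ℝ := d.2.2.1

/-- The treatment indicator `T`. -/
def treatment {p : ℕ} (d : FullData p) : Bool := d.2.2.2

/-- The individual treatment effect `Δ = Y(1) - Y(0)`. -/
def effect {p : ℕ} (d : FullData p) : ℝ := outcome1 d - outcome0 d

/-- The observed part `(X, Y, T)` of a unit, with `Y = T Y(1) + (1 - T) Y(0)`. -/
def observe {p : ℕ} (d : FullData p) : ObsData p :=
  (covariate d, if treatment d = true then outcome1 d else outcome0 d, treatment d)

theorem measurable_covariate {p : ℕ} : Measurable (covariate (p := p)) := measurable_fst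

/-- The σ-algebra `σ(X)` on the space of full data. -/
abbrev sigmaX (p : ℕ) : MeasurableSpace (FullData p) :=
  MeasurableSpace.comap covariate inferInstance

theorem sigmaX_le (p : ℕ) :
    sigmaX p ≤ (inferInstance : MeasurableSpace (FullData p)) :=
  measurable_covariate.comap_le

/-- The two usual meanings of "continuous distribution" on the real line. -/
inductive Continuity : Type
  | absolutelyContinuous
  | atomless

/-- The law `μ` on `ℝ` is continuous in the chosen sense: it has a Lebesgue density, or it has no
atoms (equivalently, a continuous distribution function). -/
def Continuity.Holds : Continuity → Measure ℝ → Prop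
  | .absolutelyContinuous, μ => μ ≪ volume
  | .atomless, μ => ∀ x : ℝ, μ {x} = 0

/-- The class `𝓔`: some coordinate of `X` has an absolutely continuous law, and the laws of `Y(1)`
and of `Y(0)` are continuous. (`T` is binary by its type.) -/
def classE (κ : Continuity) (p : ℕ) : Set (ProbabilityMeasure (FullData p)) :=
  {P | (∃ j : Fin p, (P : Measure (FullData p)).map (fun d => covariate d j) ≪ volume) ∧
    κ.Holds ((P : Measure (FullData p)).map outcome1) ∧
    κ.Holds ((P : Measure (FullData p)).map outcome0)}

/-- The strongly ignorable distributions: those in `𝓔` with `(Y(1), Y(0)) ⊥ T ∣ X`. -/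
def classSI (κ : Continuity) (p : ℕ) : Set (ProbabilityMeasure (FullData p)) :=
  {P | P ∈ classE κ p ∧
    CondIndepFun (sigmaX p) (sigmaX_le p) (fun d => (outcome1 d, outcome0 d)) treatment
      (P : Measure (FullData p))}

/-- The propensity score `e_P(X) = P(T = 1 ∣ X)`, as a random variable on the full data. -/
noncomputable def propensity {p : ℕ} (P : ProbabilityMeasure (FullData p)) : FullData p → ℝ :=
  (P : Measure (FullData p))⟦treatment ⁻¹' {true} | sigmaX p⟧

/-- The strongly ignorable distributions with strong overlap: `e_P(X) ∈ [c_P, 1 - c_P]` almost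
surely, for some `c_P > 0` that may depend on `P`. -/
def classSIstr (κ : Continuity) (p : ℕ) : Set (ProbabilityMeasure (FullData p)) :=
  {P | P ∈ classSI κ p ∧
    ∃ c : ℝ, 0 < c ∧ ∀ᵐ d ∂(P : Measure (FullData p)), propensity P d ∈ Set.Icc c (1 - c)}

/-- A (possibly randomized) prediction set built from `n` observed units and a random seed in `S`;
a one-point `S` gives the non-randomized ones. The indicator of `y ∈ Ĉ(x)` is jointly measurable in
the observed data, the seed, `x` and `y`. -/
structure PredictionSet (p n : ℕ) (S : Type*) [MeasurableSpace S] where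
  /-- The set `Ĉ(x)` for given observed data, seed and `x`. -/
  toSet : (Fin n → ObsData p) → S → (Fin p → ℝ) → Set ℝ
  measurable_mem : MeasurableSet
    {z : (Fin n → ObsData p) × S × (Fin p → ℝ) × ℝ | z.2.2.2 ∈ toSet z.1 z.2.1 z.2.2.1}

section Sampling

variable {p n : ℕ} {S : Type*} [MeasurableSpace S]

/-- Joint law of `n` i.i.d. units from `P`, a seed with law `ν`, and a new unit from `P`, all
independent. -/
noncomputable def experiment (n : ℕ) (ν : Measure S) (P : ProbabilityMeasure (FullData p)) :
    Measure ((Fin n → FullData p) × S × FullData p) :=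
  (Measure.pi fun _ : Fin n => (P : Measure (FullData p))).prod
    (ν.prod (P : Measure (FullData p)))

/-- The realized prediction set `Ĉ(X)` at the covariate of the new unit. -/
def PredictionSet.realized (C : PredictionSet p n S)
    (ω : (Fin n → FullData p) × S × FullData p) : Set ℝ :=
  C.toSet (fun i => observe (ω.1 i)) ω.2.1 (covariate ω.2.2)

/-- `ℙ_P(Δ ∉ Ĉ(X))`. -/
noncomputable def PredictionSet.miscoverage (C : PredictionSet p n S) (ν : Measure S)
    (P : ProbabilityMeasure (FullData p)) : ENNReal :=
  experiment n ν P {ω | effect ω.2.2 ∉ C.realized ω}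

/-- `ℙ_P(y ∉ Ĉ(X))` for a fixed real number `y`. -/
noncomputable def PredictionSet.missProb (C : PredictionSet p n S) (ν : Measure S)
    (P : ProbabilityMeasure (FullData p)) (y : ℝ) : ENNReal :=
  experiment n ν P {ω | y ∉ C.realized ω}

/-- `𝔼_P[length Ĉ(X)] ∈ [0, ∞]`, where length is Lebesgue measure. -/
noncomputable def PredictionSet.expectedLength (C : PredictionSet p n S) (ν : Measure S)
    (P : ProbabilityMeasure (FullData p)) : ENNReal :=
  ∫⁻ ω, volume (C.realized ω) ∂(experiment n ν P)

end Sampling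

end ITE

/-! For each fixed `n` and `y`, missing `y` under any strongly ignorable `P` is at most as likely as
the worst miscoverage of the effect under strong overlap (`missProb_le_iSup_miscoverage`). Both
conclusions follow from this bound.

If treatment were a deterministic function `a(X)`, only one outcome per unit would ever be seen, and
the other could be imputed so that the effect is exactly `y`. Flipping the arm independently with
probability `c` gives a law `Q` with strong overlap (`surrogateLaw_mem_classSIstr`). Its observed
sample law dominates `(1 - c) ^ n` times the original one, and under `Q` missing the effect means
missing `y`.

A general `P` is reduced to this case by derandomization. By strong ignorability, treatment may be
redrawn as `V ≤ e(X)` with `V` uniform and independent (`map_reassign_eq`). Replace the `V` of a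
unit by a uniform variable attached to the cell of width `1 / N` containing a coordinate of `X`.
While the sample occupies distinct cells nothing changes in law, and for an absolutely continuous
coordinate collisions vanish as `N → ∞` (`tendsto_cell_collision`). Once the cell variables are
frozen, treatment is a function of `X`, so the first case applies
(`lintegral_thresholdSample_cell_le`). Average over them, then let `N → ∞` and `c → 0`. -/

namespace ITE

/-! ### Conditional independence through integrals over conditioning events -/

section ConditionalIndependence

variable {Ω : Type*} {m mΩ : MeasurableSpace Ω} {μ : Measure Ω}

/-- The indicator of `D ∩ E` and `q` times the indicator of `D` have equal integrals over every
`m`-measurable set, hence equal conditional expectations; the `m`-measurable factor `q` then pulls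
out. -/
theorem condProb_inter_eq_mul (hm : m ≤ mΩ) [IsFiniteMeasure μ] {D E : Set Ω} {q : Ω → ℝ}
    (hD : MeasurableSet D) (hE : MeasurableSet E) (hq : StronglyMeasurable[m] q)
    (c : ℝ) (hc : ∀ ω, ‖q ω‖ ≤ c)
    (h : ∀ B, MeasurableSet[m] B → μ.real (B ∩ (D ∩ E)) = ∫ ω in B ∩ D, q ω ∂μ) :
    μ⟦D ∩ E | m⟧ =ᵐ[μ] fun ω => q ω * (μ⟦D | m⟧) ω := by
  have hint : Integrable (q * D.indicator fun _ => (1 : ℝ)) μ :=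
    ((integrable_const (1 : ℝ)).indicator hD).bdd_mul (hq.mono hm).aestronglyMeasurable
      (ae_of_all _ hc)
  have h1 : μ[q * D.indicator (fun _ => (1 : ℝ)) | m] =ᵐ[μ] μ⟦D ∩ E | m⟧ := by
    refine ae_eq_condExp_of_forall_setIntegral_eq hm
      ((integrable_const (1 : ℝ)).indicator (hD.inter hE))
      (fun s _ _ => integrable_condExp.integrableOn) (fun B hB _ => ?_)
      stronglyMeasurable_condExp.aestronglyMeasurable
    rw [setIntegral_condExp hm hint hB]
    have e1 : (q * D.indicator fun _ => (1 : ℝ)) = D.indicator q := by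
      ext ω; by_cases hω : ω ∈ D <;> simp [hω]
    rw [e1, setIntegral_indicator hD, ← h B hB, setIntegral_indicator (hD.inter hE)]
    simp
  refine h1.symm.trans ?_
  exact condExp_mul_of_stronglyMeasurable_left hq hint
    ((integrable_const (1 : ℝ)).indicator hD)

theorem condIndepFun_of_forall_real_eq [StandardBorelSpace Ω] {β γ : Type*} [MeasurableSpace β]
    [MeasurableSpace γ] (hm : m ≤ mΩ) [IsFiniteMeasure μ] {f : Ω → β} {g : Ω → γ}
    (hf : Measurable f) (hg : Measurable g) {q : Set γ → Ω → ℝ}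
    (hq : ∀ t, MeasurableSet t → StronglyMeasurable[m] (q t)) (c : ℝ) (hc : ∀ t ω, ‖q t ω‖ ≤ c)
    (h : ∀ B s t, MeasurableSet[m] B → MeasurableSet s → MeasurableSet t →
      μ.real (B ∩ (f ⁻¹' s ∩ g ⁻¹' t)) = ∫ ω in B ∩ f ⁻¹' s, q t ω ∂μ) :
    CondIndepFun m hm f g μ ∧ ∀ t, MeasurableSet t → μ⟦g ⁻¹' t | m⟧ =ᵐ[μ] q t := by
  have hp : ∀ t, MeasurableSet t → μ⟦g ⁻¹' t | m⟧ =ᵐ[μ] q t := by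
    intro t ht
    -- Taking `D` to be the whole space identifies `q t` as the conditional probability of the
    -- event.
    have := condProb_inter_eq_mul (μ := μ) hm MeasurableSet.univ (hg ht) (hq t ht) c (hc t)
      (fun B hB => by simpa using h B Set.univ t hB MeasurableSet.univ ht)
    simpa [condExp_const hm] using this
  refine ⟨(condIndepFun_iff_condExp_inter_preimage_eq_mul hf hg).2 fun s t hs ht => ?_, hp⟩
  filter_upwards [condProb_inter_eq_mul (μ := μ) hm (hf hs) (hg ht) (hq t ht) c (hc t)
    (fun B hB => h B s t hB hs ht), hp t ht] with ω h1 h2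
  rw [h1, h2, mul_comm]

theorem CondIndepFun.real_inter_eq [StandardBorelSpace Ω] {β γ : Type*} [MeasurableSpace β]
    [MeasurableSpace γ] {hm : m ≤ mΩ} [IsFiniteMeasure μ] {f : Ω → β} {g : Ω → γ}
    (hfg : CondIndepFun m hm f g μ)
    (hf : Measurable f) (hg : Measurable g) {B : Set Ω} {s : Set β} {t : Set γ}
    (hB : MeasurableSet[m] B) (hs : MeasurableSet s) (ht : MeasurableSet t) :
    μ.real (B ∩ (f ⁻¹' s ∩ g ⁻¹' t)) = ∫ ω in B ∩ f ⁻¹' s, (μ⟦g ⁻¹' t | m⟧) ω ∂μ := by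
  have hD := hf hs
  have hE := hg ht
  set D := f ⁻¹' s
  set E := g ⁻¹' t
  have e1 : (D.indicator (fun _ => (1 : ℝ)) * (μ⟦E | m⟧)) = D.indicator (μ⟦E | m⟧) := by
    ext ω; by_cases hω : ω ∈ D <;> simp [hω]
  have hint : Integrable (D.indicator (fun _ => (1 : ℝ)) * (μ⟦E | m⟧)) μ := by
    rw [e1]; exact integrable_condExp.indicator hD
  calc μ.real (B ∩ (D ∩ E))
      = ∫ ω in B, (D ∩ E).indicator (fun _ => (1 : ℝ)) ω ∂μ := by
        rw [setIntegral_indicator (hD.inter hE)]; simp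
    _ = ∫ ω in B, (μ⟦D ∩ E | m⟧) ω ∂μ :=
        (setIntegral_condExp hm ((integrable_const (1 : ℝ)).indicator (hD.inter hE)) hB).symm
    _ = ∫ ω in B, (μ[D.indicator (fun _ => (1 : ℝ)) * (μ⟦E | m⟧) | m]) ω ∂μ := by
        refine setIntegral_congr_ae (hm _ hB) ?_
        filter_upwards [(condIndepFun_iff_condExp_inter_preimage_eq_mul hf hg).1 hfg s t hs ht,
          condExp_mul_of_stronglyMeasurable_right (μ := μ) (stronglyMeasurable_condExp (m := m))
            hint ((integrable_const (1 : ℝ)).indicator hD)] with ω h1 h2 _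
        rw [h1, h2]; rfl
    _ = ∫ ω in B ∩ D, (μ⟦E | m⟧) ω ∂μ := by
        rw [setIntegral_condExp hm hint hB, e1, setIntegral_indicator hD]

end ConditionalIndependence

/-! ### Finite powers and coordinate samples of product measures -/

section ProductMeasures

/-- Scaled domination between measures passes to finite powers. -/
theorem smul_pi_le_pi {ι α : Type*} [Fintype ι] [MeasurableSpace α] {μ ρ : Measure α}
    [SigmaFinite μ] {a : ENNReal} (h : a • μ ≤ ρ) :
    a ^ Fintype.card ι • Measure.pi (fun _ : ι => μ) ≤ Measure.pi (fun _ : ι => ρ) := by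
  have key : (a ^ Fintype.card ι • Measure.pi (fun _ : ι => μ)).toOuterMeasure ≤
      OuterMeasure.pi (fun _ : ι => ρ.toOuterMeasure) := by
    -- The product outer measure is the largest one bounded by the product on boxes, so only boxes
    -- need checking.
    refine OuterMeasure.le_pi.2 fun s _ => ?_
    calc (a ^ Fintype.card ι • Measure.pi (fun _ : ι => μ)) (Set.pi Set.univ s)
        = ∏ i, a * μ (s i) := by
          simp [Measure.pi_pi, Finset.prod_mul_distrib]
      _ ≤ ∏ i, ρ (s i) := Finset.prod_le_prod' fun i _ => h (s i)
  refine Measure.le_iff.2 fun s hs => ?_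
  have hρ : Measure.pi (fun _ : ι => ρ) s = OuterMeasure.pi (fun _ : ι => ρ.toOuterMeasure) s := by
    rw [Measure.pi, toMeasure_apply _ _ hs]
  rw [hρ]
  exact key s

/-- Reading an i.i.d. family along an injective finite sequence of indices gives an i.i.d. sample. -/
theorem map_infinitePi_comp_injective {ι κ α : Type*} [Fintype κ] [MeasurableSpace α]
    (lam : Measure α) [IsProbabilityMeasure lam] {k : κ → ι} (hk : Function.Injective k) :
    (Measure.infinitePi (fun _ : ι => lam)).map (fun u i => u (k i)) =
      Measure.pi (fun _ : κ => lam) := by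
  have h : iIndepFun (fun (i : κ) (u : ι → α) => u (k i)) (Measure.infinitePi fun _ : ι => lam) :=
    iIndepFun.precomp hk (iIndepFun_infinitePi (X := fun _ x => x) (fun _ => measurable_id))
  rw [(iIndepFun_iff_map_fun_eq_pi_map fun i => (measurable_pi_apply (k i)).aemeasurable).1 h]
  congr 1
  ext1 i
  exact Measure.infinitePi_map_eval (fun _ : ι => lam) (k i)

end ProductMeasures

/-! ### Surrogate laws with constant effect and strong overlap -/

section Surrogate

variable {p : ℕ}

theorem measurable_outcome1 : Measurable (outcome1 (p := p)) :=
  measurable_fst.comp measurable_snd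

theorem measurable_outcome0 : Measurable (outcome0 (p := p)) :=
  measurable_fst.comp (measurable_snd.comp measurable_snd)

theorem measurable_treatment : Measurable (treatment (p := p)) :=
  measurable_snd.comp (measurable_snd.comp measurable_snd)

/-- The record `(X, Y(t), t)` of a unit assigned to the arm `t`. -/
def observeAs (t : Bool) (d : FullData p) : ObsData p :=
  (covariate d, if t = true then outcome1 d else outcome0 d, t)

theorem measurable_observeAs_uncurry :
    Measurable (fun z : Bool × FullData p => observeAs z.1 z.2) := by
  refine (measurable_covariate.comp measurable_snd).prodMk (Measurable.prodMk ?_ measurable_fst)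
  exact Measurable.ite (measurable_fst (measurableSet_singleton true))
    (measurable_outcome1.comp measurable_snd) (measurable_outcome0.comp measurable_snd)

theorem measurable_observe : Measurable (observe (p := p)) :=
  measurable_observeAs_uncurry.comp (measurable_treatment.prodMk measurable_id)

/-- A unit whose effect is exactly `y`: where `a` selects treatment `Y(1)` is kept and `Y(0)` is
imputed, elsewhere `Y(0)` is kept and `Y(1)` is imputed. The assigned arm is `a`, flipped by `b`. -/
def surrogate (a : (Fin p → ℝ) → Bool) (y : ℝ) (b : Bool) (d : FullData p) : FullData p :=
  (covariate d, if a (covariate d) = true then outcome1 d else outcome0 d + y,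
    if a (covariate d) = true then outcome1 d - y else outcome0 d, xor (a (covariate d)) b)

variable {a : (Fin p → ℝ) → Bool} {y c : ℝ} {b : Bool}

theorem measurable_surrogate (ha : Measurable a) : Measurable (surrogate a y b) := by
  have hA : MeasurableSet {d : FullData p | a (covariate d) = true} :=
    (ha.comp measurable_covariate) (measurableSet_singleton true)
  refine measurable_covariate.prodMk (Measurable.prodMk ?_ (Measurable.prodMk ?_ ?_))
  · exact Measurable.ite hA measurable_outcome1 (measurable_outcome0.add_const y)
  · exact Measurable.ite hA (measurable_outcome1.sub_const y) measurable_outcome0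
  · exact (measurable_from_top (f := fun t => xor t b)).comp (ha.comp measurable_covariate)

theorem effect_surrogate (d : FullData p) : effect (surrogate a y b d) = y := by
  by_cases h : a (covariate d) = true <;> simp [effect, surrogate, outcome1, outcome0, h]

/-- Without a flip the assigned arm is the one whose outcome was kept, so the imputed value is never
seen. -/
theorem observe_surrogate_false (d : FullData p) :
    observe (surrogate a y false d) = observeAs (a (covariate d)) d := by
  by_cases h : a (covariate d) = true <;>
    simp [observe, observeAs, surrogate, outcome1, outcome0, covariate, treatment] at h ⊢ <;>
    simp [h]

/-- The law of surrogate units whose arm is flipped with probability `c`. -/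
noncomputable def surrogateLaw (μ : Measure (FullData p)) (a : (Fin p → ℝ) → Bool) (y c : ℝ) :
    Measure (FullData p) :=
  ENNReal.ofReal (1 - c) • μ.map (surrogate a y false) +
    ENNReal.ofReal c • μ.map (surrogate a y true)

variable {μ : Measure (FullData p)}

theorem surrogateLaw_apply (ha : Measurable a) {W : Set (FullData p)} (hW : MeasurableSet W) :
    surrogateLaw μ a y c W = ENNReal.ofReal (1 - c) * μ (surrogate a y false ⁻¹' W) +
      ENNReal.ofReal c * μ (surrogate a y true ⁻¹' W) := by
  simp [surrogateLaw, Measure.map_apply (measurable_surrogate ha) hW]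

/-- Meant for events not involving treatment: the flip does not affect them, and the two weights sum
to one. -/
theorem surrogateLaw_apply_of_eq (ha : Measurable a) (hc₀ : 0 ≤ c) (hc₁ : c ≤ 1)
    {W : Set (FullData p)} (hW : MeasurableSet W) {V : Set (FullData p)}
    (h : ∀ b, surrogate a y b ⁻¹' W = V) : surrogateLaw μ a y c W = μ V := by
  rw [surrogateLaw_apply ha hW, h, h, ← add_mul, ← ENNReal.ofReal_add (by linarith) hc₀]
  simp

theorem isProbabilityMeasure_surrogateLaw [IsProbabilityMeasure μ] (ha : Measurable a)
    (hc₀ : 0 ≤ c) (hc₁ : c ≤ 1) : IsProbabilityMeasure (surrogateLaw μ a y c) :=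
  ⟨by rw [surrogateLaw_apply_of_eq ha hc₀ hc₁ MeasurableSet.univ (V := Set.univ) (by simp),
    measure_univ]⟩

theorem map_covariate_surrogateLaw (ha : Measurable a) (hc₀ : 0 ≤ c) (hc₁ : c ≤ 1) :
    (surrogateLaw μ a y c).map covariate = μ.map covariate := by
  ext s hs
  rw [Measure.map_apply measurable_covariate hs, Measure.map_apply measurable_covariate hs,
    surrogateLaw_apply_of_eq ha hc₀ hc₁ (measurable_covariate hs)
      (V := covariate ⁻¹' s) (fun b => rfl)]

theorem ae_effect_surrogateLaw (ha : Measurable a) :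
    ∀ᵐ d ∂(surrogateLaw μ a y c), effect d = y := by
  have hm : MeasurableSet {d : FullData p | effect d = y} :=
    (measurable_outcome1.sub measurable_outcome0) (measurableSet_singleton y)
  have hb : ∀ b, ∀ᵐ d ∂(μ.map (surrogate a y b)), effect d = y := fun b =>
    (ae_map_iff (measurable_surrogate ha).aemeasurable hm).2 (ae_of_all _ effect_surrogate)
  rw [surrogateLaw, ae_add_measure_iff]
  exact ⟨Measure.ae_smul_measure (hb _) _, Measure.ae_smul_measure (hb _) _⟩

/-- The unflipped component of the mixture alone has weight `1 - c` and observes exactly the record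
of arm `a(X)`. -/
theorem smul_map_observeAs_le (ha : Measurable a) :
    ENNReal.ofReal (1 - c) • μ.map (fun d => observeAs (a (covariate d)) d) ≤
      (surrogateLaw μ a y c).map observe := by
  have h : μ.map (fun d => observeAs (a (covariate d)) d) =
      (μ.map (surrogate a y false)).map observe := by
    rw [Measure.map_map measurable_observe (measurable_surrogate ha)]
    congr 1
    ext1 d
    exact (observe_surrogate_false d).symm
  rw [h, surrogateLaw, Measure.map_add _ _ measurable_observe, Measure.map_smul]
  exact Measure.le_add_right le_rfl

theorem Continuity.Holds.of_le_add {κ : Continuity} {ρ ρ₁ ρ₂ : Measure ℝ} (h₁ : κ.Holds ρ₁)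
    (h₂ : κ.Holds ρ₂) (h : ρ ≤ ρ₁ + ρ₂) : κ.Holds ρ := by
  cases κ with
  | absolutelyContinuous =>
    have h₁ : ρ₁ ≪ volume := h₁
    have h₂ : ρ₂ ≪ volume := h₂
    exact (Measure.absolutelyContinuous_of_le h).trans (Measure.AbsolutelyContinuous.add_left h₁ h₂)
  | atomless =>
    intro x
    refine le_antisymm ((h {x}).trans ?_) zero_le
    simp [h₁ x, h₂ x]

theorem Continuity.Holds.map_add_const {κ : Continuity} {ρ : Measure ℝ} (h : κ.Holds ρ) (z : ℝ) :
    κ.Holds (ρ.map (· + z)) := by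
  cases κ with
  | absolutelyContinuous =>
    have h : ρ ≪ volume := h
    have := h.map (measurable_add_const z)
    rwa [map_add_right_eq_self (volume : Measure ℝ) z] at this
  | atomless =>
    intro x
    rw [Measure.map_apply (measurable_add_const z) (measurableSet_singleton x)]
    have : (fun t : ℝ => t + z) ⁻¹' {x} = {x - z} := by
      ext t; exact eq_sub_iff_add_eq.symm
    rw [this]
    exact h _

/-- The covariate law is unchanged, and each surrogate outcome is either an original outcome or a
translate of the other one. Its law is thus dominated by a sum of two continuous laws. -/
theorem surrogateLaw_mem_classE {κ : Continuity} {P : ProbabilityMeasure (FullData p)}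
    (hP : P ∈ classE κ p) (ha : Measurable a) (hc₀ : 0 ≤ c) (hc₁ : c ≤ 1)
    {Q : ProbabilityMeasure (FullData p)} (hQ : (Q : Measure (FullData p)) = surrogateLaw P a y c) :
    Q ∈ classE κ p := by
  obtain ⟨⟨j, hj⟩, h1, h0⟩ := hP
  refine ⟨⟨j, ?_⟩, ?_, ?_⟩
  · have h : ∀ R : Measure (FullData p), R.map (fun d => covariate d j) =
        (R.map covariate).map (fun x => x j) := fun R =>
      (Measure.map_map (measurable_pi_apply j) measurable_covariate).symm
    rwa [h, hQ, map_covariate_surrogateLaw ha hc₀ hc₁, ← h]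
  · refine h1.of_le_add (h0.map_add_const y) (Measure.le_iff.2 fun s hs => ?_)
    rw [hQ, Measure.map_apply measurable_outcome1 hs,
      surrogateLaw_apply_of_eq ha hc₀ hc₁ (measurable_outcome1 hs)
        (V := surrogate a y false ⁻¹' (outcome1 ⁻¹' s)) (fun b => rfl),
      Measure.add_apply, Measure.map_map (measurable_add_const y) measurable_outcome0,
      Measure.map_apply measurable_outcome1 hs,
      Measure.map_apply ((measurable_add_const y).comp measurable_outcome0) hs]
    refine (measure_mono ?_).trans (measure_union_le _ _)
    intro d hd
    by_cases h : a (covariate d) = true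
    · exact Or.inl (by simpa [surrogate, outcome1, h] using hd)
    · exact Or.inr (by simpa [surrogate, outcome1, h] using hd)
  · refine h0.of_le_add (h1.map_add_const (-y)) (Measure.le_iff.2 fun s hs => ?_)
    rw [hQ, Measure.map_apply measurable_outcome0 hs,
      surrogateLaw_apply_of_eq ha hc₀ hc₁ (measurable_outcome0 hs)
        (V := surrogate a y false ⁻¹' (outcome0 ⁻¹' s)) (fun b => rfl),
      Measure.add_apply, Measure.map_map (measurable_add_const _) measurable_outcome1,
      Measure.map_apply measurable_outcome0 hs,
      Measure.map_apply ((measurable_add_const _).comp measurable_outcome1) hs]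
    refine (measure_mono ?_).trans (measure_union_le _ _)
    intro d hd
    by_cases h : a (covariate d) = true
    · exact Or.inr (by simpa [surrogate, outcome0, h, sub_eq_add_neg] using hd)
    · exact Or.inl (by simpa [surrogate, outcome0, h] using hd)

theorem surrogateLaw_real_apply [IsProbabilityMeasure μ] (ha : Measurable a) (hc₀ : 0 ≤ c)
    (hc₁ : c ≤ 1) {W : Set (FullData p)} (hW : MeasurableSet W) :
    (surrogateLaw μ a y c).real W = (1 - c) * μ.real (surrogate a y false ⁻¹' W) +
      c * μ.real (surrogate a y true ⁻¹' W) := by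
  rw [Measure.real, surrogateLaw_apply ha hW, ENNReal.toReal_add (by finiteness) (by finiteness),
    ENNReal.toReal_mul, ENNReal.toReal_mul, ENNReal.toReal_ofReal (by linarith),
    ENNReal.toReal_ofReal hc₀]
  rfl

/-- The conditional probability under the surrogate law that the assigned arm is in `t`. -/
noncomputable def armProb (a : (Fin p → ℝ) → Bool) (c : ℝ) (t : Set Bool) (d : FullData p) : ℝ :=
  (1 - c) * ((fun d => a (covariate d)) ⁻¹' t).indicator 1 d +
    c * ((fun d => !a (covariate d)) ⁻¹' t).indicator 1 d

/-- Given `X`, the arm is determined by the flip alone, which is independent of the outcomes. -/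
theorem surrogateLaw_condIndepFun [IsProbabilityMeasure μ]
    [IsProbabilityMeasure (surrogateLaw μ a y c)] (ha : Measurable a) (hc₀ : 0 ≤ c) (hc₁ : c ≤ 1) :
    CondIndepFun (sigmaX p) (sigmaX_le p) (fun d => (outcome1 d, outcome0 d)) treatment
        (surrogateLaw μ a y c) ∧
      ∀ t, MeasurableSet t → (surrogateLaw μ a y c)⟦treatment ⁻¹' t | sigmaX p⟧
        =ᵐ[surrogateLaw μ a y c] armProb a c t := by
  have hout : Measurable (fun d : FullData p => (outcome1 d, outcome0 d)) :=
    measurable_outcome1.prodMk measurable_outcome0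
  have hnot : Measurable (fun x => !a x) := (measurable_from_top (f := fun t => !t)).comp ha
  refine condIndepFun_of_forall_real_eq (sigmaX_le p) hout measurable_treatment
    (q := armProb a c) ?_ 1 ?_ ?_
  · intro t ht
    have hX : Measurable[sigmaX p] (covariate (p := p)) := comap_measurable _
    have hfun : Measurable fun x => (1 - c) * (a ⁻¹' t).indicator (1 : (Fin p → ℝ) → ℝ) x +
        c * ((fun x => !a x) ⁻¹' t).indicator (1 : (Fin p → ℝ) → ℝ) x :=
      ((measurable_one.indicator (ha ht)).const_mul _).add
        ((measurable_one.indicator (hnot ht)).const_mul _)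
    exact (hfun.comp hX).stronglyMeasurable
  · intro t d
    rw [Real.norm_eq_abs, abs_le]
    unfold armProb
    by_cases h1 : a (covariate d) ∈ t <;> by_cases h2 : (!a (covariate d)) ∈ t <;>
      simp [h1, h2] <;> constructor <;> linarith
  · rintro _ s t ⟨B, hB, rfl⟩ hs ht
    set W := covariate ⁻¹' B ∩ (fun d : FullData p => (outcome1 d, outcome0 d)) ⁻¹' s with hWdef
    set A := (fun d : FullData p => a (covariate d)) ⁻¹' t with hAdef
    set A' := (fun d : FullData p => !a (covariate d)) ⁻¹' t with hAdef'
    have hW : MeasurableSet W := (measurable_covariate hB).inter (hout hs)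
    have hA : MeasurableSet A := (ha.comp measurable_covariate) ht
    have hA' : MeasurableSet A' := (hnot.comp measurable_covariate) ht
    have hi : ∀ (r : ℝ) (V : Set (FullData p)), MeasurableSet V →
        Integrable (fun d => r * V.indicator (1 : FullData p → ℝ) d) (surrogateLaw μ a y c) :=
      fun r V hV => ((integrable_const (1 : ℝ)).indicator hV).const_mul r
    have hr : ∀ (r : ℝ) (V : Set (FullData p)), MeasurableSet V →
        ∫ d in W, r * V.indicator (1 : FullData p → ℝ) d ∂(surrogateLaw μ a y c) =
          r * (surrogateLaw μ a y c).real (W ∩ V) := by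
      intro r V hV
      rw [integral_const_mul, setIntegral_indicator hV]
      simp
    -- The flip enters only the treatment coordinate, while `W`, `A` and `A'` constrain only
    -- covariates and outcomes.
    have eW : surrogate a y true ⁻¹' W = surrogate a y false ⁻¹' W := rfl
    have eA : ∀ b, surrogate a y b ⁻¹' A = A := fun b => rfl
    have eA' : ∀ b, surrogate a y b ⁻¹' A' = A' := fun b => rfl
    have ef : surrogate a y false ⁻¹' (treatment ⁻¹' t) = A := by
      ext d; simp [surrogate, treatment, hAdef]
    have et : surrogate a y true ⁻¹' (treatment ⁻¹' t) = A' := by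
      ext d; simp [surrogate, treatment, hAdef']
    have hsplit : ∫ d in W, armProb a c t d ∂(surrogateLaw μ a y c) =
        (1 - c) * (surrogateLaw μ a y c).real (W ∩ A) +
          c * (surrogateLaw μ a y c).real (W ∩ A') := by
      rw [← hr _ _ hA, ← hr _ _ hA']
      exact integral_add (hi _ _ hA).integrableOn (hi _ _ hA').integrableOn
    rw [hsplit, ← Set.inter_assoc,
      surrogateLaw_real_apply ha hc₀ hc₁ (hW.inter (measurable_treatment ht)),
      surrogateLaw_real_apply ha hc₀ hc₁ (hW.inter hA),
      surrogateLaw_real_apply ha hc₀ hc₁ (hW.inter hA')]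
    simp only [Set.preimage_inter, eW, eA, eA', ef, et]
    ring

theorem surrogateLaw_mem_classSIstr {κ : Continuity} {P : ProbabilityMeasure (FullData p)}
    (hP : P ∈ classE κ p) (ha : Measurable a) (hc₀ : 0 < c) (hc₁ : c ≤ 1 / 2)
    {Q : ProbabilityMeasure (FullData p)} (hQ : (Q : Measure (FullData p)) = surrogateLaw P a y c) :
    Q ∈ classSIstr κ p := by
  have hprob : IsProbabilityMeasure (surrogateLaw (P : Measure (FullData p)) a y c) :=
    isProbabilityMeasure_surrogateLaw ha hc₀.le (by linarith)
  obtain ⟨hci, hprop⟩ := surrogateLaw_condIndepFun (μ := (P : Measure (FullData p))) (y := y)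
    ha hc₀.le (by linarith)
  refine ⟨⟨surrogateLaw_mem_classE hP ha hc₀.le (by linarith) hQ, ?_⟩, c, hc₀, ?_⟩
  · convert! hci
  · unfold propensity
    rw [hQ]
    filter_upwards [hprop {true} (measurableSet_singleton _)] with d hd
    rw [hd]
    unfold armProb
    -- The propensity is `1 - c` or `c`; both lie in `[c, 1 - c]` because `c ≤ 1 / 2`.
    by_cases h : a (covariate d) = true <;> simp [h] <;> linarith

end Surrogate

/-! ### Redrawing treatment from the propensity score -/

section Reassignment

variable {p : ℕ}

/-- The uniform law on `[0, 1]`. -/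
noncomputable def unifLaw : Measure ℝ := volume.restrict (Set.Icc 0 1)

instance : IsProbabilityMeasure unifLaw := ⟨by simp [unifLaw]⟩

theorem unifLaw_Iic {r : ℝ} (hr : r ∈ Set.Icc (0 : ℝ) 1) :
    unifLaw (Set.Iic r) = ENNReal.ofReal r := by
  have : Set.Iic r ∩ Set.Icc 0 1 = Set.Icc 0 r := by
    ext v
    simp only [Set.mem_inter_iff, Set.mem_Iic, Set.mem_Icc]
    exact ⟨fun h => ⟨h.2.1, h.1⟩, fun h => ⟨h.2, h.1, h.2.trans hr.2⟩⟩
  rw [unifLaw, Measure.restrict_apply measurableSet_Iic, this, Real.volume_Icc, sub_zero]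

/-- Replace the treatment of a unit. -/
def reassign (t : Bool) (d : FullData p) : FullData p := (covariate d, outcome1 d, outcome0 d, t)

theorem measurable_reassign_uncurry :
    Measurable (fun z : Bool × FullData p => reassign z.1 z.2) :=
  (measurable_covariate.comp measurable_snd).prodMk
    ((measurable_outcome1.comp measurable_snd).prodMk
      ((measurable_outcome0.comp measurable_snd).prodMk measurable_fst))

theorem measurable_decide_le {Ω : Type*} [MeasurableSpace Ω] {f g : Ω → ℝ} (hf : Measurable f)
    (hg : Measurable g) : Measurable (fun ω => decide (f ω ≤ g ω)) := by
  refine measurable_to_bool ?_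
  have : (fun ω => decide (f ω ≤ g ω)) ⁻¹' {true} = {ω | f ω ≤ g ω} := by ext; simp
  rw [this]
  exact measurableSet_le hf hg

theorem measure_bool_ext {ρ₁ ρ₂ : Measure Bool} [IsFiniteMeasure ρ₁]
    (hu : ρ₁ Set.univ = ρ₂ Set.univ) (ht : ρ₁ {true} = ρ₂ {true}) : ρ₁ = ρ₂ := by
  have : IsFiniteMeasure ρ₂ := ⟨hu ▸ measure_lt_top ρ₁ _⟩
  refine Measure.ext_of_singleton fun b => ?_
  cases b with
  | true => exact ht
  | false =>
    have : ({false} : Set Bool) = {true}ᶜ := by ext b; cases b <;> simp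
    rw [this, measure_compl (measurableSet_singleton _) (measure_ne_top _ _),
      measure_compl (measurableSet_singleton _) (measure_ne_top _ _), hu, ht]

theorem propensity_mem_Icc (P : ProbabilityMeasure (FullData p)) :
    ∀ᵐ d ∂(P : Measure (FullData p)), propensity P d ∈ Set.Icc (0 : ℝ) 1 := by
  have hT : MeasurableSet (treatment (p := p) ⁻¹' {true}) :=
    measurable_treatment (measurableSet_singleton _)
  have hi : Integrable ((treatment (p := p) ⁻¹' {true}).indicator fun _ => (1 : ℝ))
      (P : Measure (FullData p)) := (integrable_const (1 : ℝ)).indicator hT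
  have h0 := condExp_mono (m := sigmaX p) (integrable_zero _ ℝ (P : Measure (FullData p))) hi
    (ae_of_all _ fun d => Set.indicator_nonneg (fun _ _ => zero_le_one) d)
  have h1 := condExp_mono (m := sigmaX p) hi (integrable_const (1 : ℝ))
    (ae_of_all _ fun d => Set.indicator_le_self' (fun _ _ => zero_le_one) d)
  rw [condExp_const (sigmaX_le p)] at h1
  filter_upwards [h0, h1] with d h0 h1
  exact ⟨by simpa [propensity] using h0, h1⟩

/-- Under strong ignorability, drawing the treatment afresh with the propensity score as success
probability does not change the law of a unit. -/
theorem map_reassign_eq {P : ProbabilityMeasure (FullData p)}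
    (hP : CondIndepFun (sigmaX p) (sigmaX_le p) (fun d => (outcome1 d, outcome0 d)) treatment
      (P : Measure (FullData p)))
    {e : (Fin p → ℝ) → ℝ} (he : Measurable e) (hePx : propensity P = e ∘ covariate) :
    ((P : Measure (FullData p)).prod unifLaw).map
      (fun z => reassign (decide (z.2 ≤ e (covariate z.1))) z.1) = P := by
  have hout : Measurable (fun d : FullData p => (outcome1 d, outcome0 d)) :=
    measurable_outcome1.prodMk measurable_outcome0
  have hdec : Measurable (fun z : FullData p × ℝ => decide (z.2 ≤ e (covariate z.1))) :=
    measurable_decide_le measurable_snd (he.comp (measurable_covariate.comp measurable_fst))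
  have hre : Measurable (fun z : FullData p × ℝ =>
      reassign (decide (z.2 ≤ e (covariate z.1))) z.1) :=
    measurable_reassign_uncurry.comp (hdec.prodMk measurable_fst)
  set R := ((P : Measure (FullData p)).prod unifLaw).map
      (fun z => reassign (decide (z.2 ≤ e (covariate z.1))) z.1) with hR
  have hRprob : IsProbabilityMeasure R := Measure.isProbabilityMeasure_map hre.aemeasurable
  -- The outcomes are grouped into one factor so that boxes match the events in the conditional
  -- independence hypothesis.
  let split : FullData p → (Fin p → ℝ) × (ℝ × ℝ) × Bool :=
    fun d => (covariate d, (outcome1 d, outcome0 d), treatment d)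
  let join : (Fin p → ℝ) × (ℝ × ℝ) × Bool → FullData p := fun z => (z.1, z.2.1.1, z.2.1.2, z.2.2)
  have hsplit : Measurable split := measurable_covariate.prodMk (hout.prodMk measurable_treatment)
  have hjoin : Measurable join := by fun_prop
  suffices h : R.map split = (P : Measure (FullData p)).map split by
    have h2 := congrArg (Measure.map join) h
    rw [Measure.map_map hjoin hsplit, Measure.map_map hjoin hsplit] at h2
    have : join ∘ split = id := rfl
    simpa [this] using h2
  have : IsProbabilityMeasure (R.map split) := Measure.isProbabilityMeasure_map hsplit.aemeasurable
  refine Measure.ext_prod₃ fun {B s t} hB hs ht => ?_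
  set V := covariate ⁻¹' B ∩ (fun d : FullData p => (outcome1 d, outcome0 d)) ⁻¹' s with hV
  have hVm : MeasurableSet V := (measurable_covariate hB).inter (hout hs)
  have hpre : split ⁻¹' (B ×ˢ s ×ˢ t) = treatment ⁻¹' t ∩ V := by
    ext d; simp [split, hV]; tauto
  rw [Measure.map_apply hsplit (hB.prod (hs.prod ht)), Measure.map_apply hsplit (hB.prod (hs.prod ht)),
    hpre]
  have hto : ∀ (M : Measure (FullData p)) (t : Set Bool), MeasurableSet t →
      M (treatment ⁻¹' t ∩ V) = (M.restrict V).map treatment t := fun M t ht => by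
    rw [Measure.map_apply measurable_treatment ht,
      Measure.restrict_apply (measurable_treatment ht)]
  rw [hto _ _ ht, hto _ _ ht]
  congr 1
  -- With the covariate and outcome events fixed, both sides are measures on `Bool`; total mass and
  -- the mass of `true` suffice.
  refine measure_bool_ext ?_ ?_
  · rw [← hto _ _ MeasurableSet.univ, ← hto _ _ MeasurableSet.univ, Set.preimage_univ,
      Set.univ_inter, hR, Measure.map_apply hre hVm]
    have : (fun z : FullData p × ℝ => reassign (decide (z.2 ≤ e (covariate z.1))) z.1) ⁻¹' V =
        V ×ˢ Set.univ := by
      ext z; simp [hV, reassign, covariate, outcome1, outcome0]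
    rw [this, Measure.prod_prod, measure_univ, mul_one]
  · rw [← hto _ _ (measurableSet_singleton _), ← hto _ _ (measurableSet_singleton _), hR,
      Measure.map_apply hre ((measurable_treatment (measurableSet_singleton _)).inter hVm),
      Measure.prod_apply (hre ((measurable_treatment (measurableSet_singleton _)).inter hVm))]
    have h1 : ∀ᵐ d ∂(P : Measure (FullData p)), unifLaw (Prod.mk d ⁻¹'
        ((fun z : FullData p × ℝ => reassign (decide (z.2 ≤ e (covariate z.1))) z.1) ⁻¹'
          (treatment ⁻¹' {true} ∩ V))) = V.indicator (fun d => ENNReal.ofReal (propensity P d)) d := by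
      filter_upwards [propensity_mem_Icc P] with d hd
      by_cases hdV : d ∈ V
      · rw [Set.indicator_of_mem hdV, ← unifLaw_Iic hd, hePx]
        congr 1
        ext v
        have : reassign (decide (v ≤ e (covariate d))) d ∈ V := hdV
        simp [this]
        simp [reassign, treatment]
      · rw [Set.indicator_of_notMem hdV]
        convert! measure_empty (μ := unifLaw)
        ext v
        have : reassign (decide (v ≤ e (covariate d))) d ∉ V := hdV
        simp [this]
    have hint : Integrable (propensity P) (P : Measure (FullData p)) := integrable_condExp
    rw [lintegral_congr_ae h1, lintegral_indicator hVm,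
      ← ofReal_integral_eq_lintegral_ofReal hint.integrableOn]
    · have h2 := CondIndepFun.real_inter_eq hP hout measurable_treatment
        (B := covariate ⁻¹' B) ⟨B, hB, rfl⟩ hs (measurableSet_singleton true)
      rw [← Set.inter_assoc] at h2
      unfold propensity
      rw [← h2, ofReal_measureReal, Set.inter_comm]
    · filter_upwards [ae_restrict_of_ae (propensity_mem_Icc P)] with d hd using hd.1

end Reassignment

variable {p n : ℕ}

/-! ### Dependence on observed data, and collisions of cells -/

section Coupling

/-- The probability over the seed and a covariate with law `ρ` that `y` is missed, given the
observed data. -/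
noncomputable def PredictionSet.condMissProb {S : Type*} [MeasurableSpace S]
    (C : PredictionSet p n S) (ν : Measure S) (ρ : Measure (Fin p → ℝ)) (y : ℝ)
    (o : Fin n → ObsData p) : ENNReal :=
  (ν.prod ρ) {z | y ∉ C.toSet o z.1 z.2}

variable {S : Type*} [MeasurableSpace S]

theorem PredictionSet.measurableSet_notMem (C : PredictionSet p n S) (y : ℝ) :
    MeasurableSet {z : (Fin n → ObsData p) × S × (Fin p → ℝ) | y ∉ C.toSet z.1 z.2.1 z.2.2} := by
  have h : Measurable (fun z : (Fin n → ObsData p) × S × (Fin p → ℝ) =>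
      (z.1, z.2.1, z.2.2, y)) := by fun_prop
  exact (h C.measurable_mem).compl

theorem PredictionSet.measurable_condMissProb (C : PredictionSet p n S) (ν : Measure S)
    [IsProbabilityMeasure ν] (ρ : Measure (Fin p → ℝ)) [IsProbabilityMeasure ρ] (y : ℝ) :
    Measurable (C.condMissProb ν ρ y) :=
  measurable_measure_prodMk_left (ν := ν.prod ρ) (C.measurableSet_notMem y)

/-- The miss probability depends on `P` only through the laws of the observed record and of the
covariate. This permits comparison with a surrogate law. -/
theorem PredictionSet.missProb_eq_lintegral (C : PredictionSet p n S) (ν : Measure S)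
    [IsProbabilityMeasure ν] (P : ProbabilityMeasure (FullData p)) (y : ℝ) :
    C.missProb ν P y = ∫⁻ o, C.condMissProb ν ((P : Measure (FullData p)).map covariate) y o
      ∂(Measure.pi fun _ => (P : Measure (FullData p)).map observe) := by
  have : IsProbabilityMeasure ((P : Measure (FullData p)).map observe) :=
    Measure.isProbabilityMeasure_map measurable_observe.aemeasurable
  have : IsProbabilityMeasure ((P : Measure (FullData p)).map covariate) :=
    Measure.isProbabilityMeasure_map measurable_covariate.aemeasurable
  have hobs : Measurable (fun (d : Fin n → FullData p) i => observe (d i)) :=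
    measurable_pi_lambda _ fun i => measurable_observe.comp (measurable_pi_apply i)
  have hsx : Measurable (Prod.map (id : S → S) (covariate (p := p))) :=
    measurable_id.prodMap measurable_covariate
  rw [← Measure.pi_map_pi fun _ => measurable_observe.aemeasurable,
    lintegral_map (C.measurable_condMissProb ν _ y) hobs]
  have hmeas : MeasurableSet {ω : (Fin n → FullData p) × S × FullData p | y ∉ C.realized ω} :=
    (hobs.prodMap hsx) (C.measurableSet_notMem y)
  rw [PredictionSet.missProb, experiment, Measure.prod_apply hmeas]
  refine lintegral_congr fun d => ?_
  have hν : ν.prod ((P : Measure (FullData p)).map covariate) =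
      (ν.prod (P : Measure (FullData p))).map (Prod.map id covariate) := by
    rw [← Measure.map_prod_map _ _ measurable_id measurable_covariate, Measure.map_id]
  rw [PredictionSet.condMissProb, hν, Measure.map_apply hsx]
  · rfl
  · exact measurable_prodMk_left (C.measurableSet_notMem y)

theorem PredictionSet.miscoverage_eq_missProb (C : PredictionSet p n S) (ν : Measure S)
    [IsProbabilityMeasure ν] (P : ProbabilityMeasure (FullData p)) (y : ℝ)
    (h : ∀ᵐ d ∂(P : Measure (FullData p)), effect d = y) :
    C.miscoverage ν P = C.missProb ν P y := by
  refine measure_congr ?_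
  have h2 : ∀ᵐ ω ∂(experiment n ν P), effect ω.2.2 = y :=
    (Measure.quasiMeasurePreserving_snd.comp Measure.quasiMeasurePreserving_snd).ae h
  filter_upwards [h2] with ω hω
  change (effect ω.2.2 ∉ C.realized ω) = (y ∉ C.realized ω)
  rw [hω]

/-- The cell of width `1 / N` that contains the `j`-th coordinate. -/
noncomputable def cell (N : ℕ) (j : Fin p) (d : FullData p) : ℤ := ⌊(N : ℝ) * covariate d j⌋

theorem measurable_cell (N : ℕ) (j : Fin p) : Measurable (cell N j) :=
  Int.measurable_floor.comp
    (((measurable_pi_apply j).comp measurable_covariate).const_mul (N : ℝ))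

theorem measurableSet_cell_collision (N : ℕ) (j : Fin p) :
    MeasurableSet {d : Fin n → FullData p | ¬ Function.Injective fun i => cell N j (d i)} := by
  have h : Measurable fun (d : Fin n → FullData p) i => cell N j (d i) :=
    measurable_pi_lambda _ fun i => (measurable_cell N j).comp (measurable_pi_apply i)
  exact h (MeasurableSet.of_discrete (s := {k : Fin n → ℤ | ¬ Function.Injective k}))

/-- Only the absence of atoms is needed: the diagonal is null for the product of an atomless law
with itself. -/
theorem ae_coordinate_injective {μ : Measure (FullData p)} [IsProbabilityMeasure μ] {j : Fin p}
    (hj : μ.map (fun d => covariate d j) ≪ volume) :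
    ∀ᵐ d ∂(Measure.pi fun _ : Fin n => μ), Function.Injective fun i => covariate (d i) j := by
  have hX : Measurable fun d : FullData p => covariate d j :=
    (measurable_pi_apply j).comp measurable_covariate
  have hprob : IsProbabilityMeasure (μ.map fun d => covariate d j) :=
    Measure.isProbabilityMeasure_map hX.aemeasurable
  have hatom : ∀ x, (μ.map fun d => covariate d j) {x} = 0 := fun x => hj (by simp)
  have hpair : ∀ i i' : Fin n, i ≠ i' →
      ∀ᵐ d ∂(Measure.pi fun _ : Fin n => μ), covariate (d i) j ≠ covariate (d i') j := by
    intro i i' hii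
    have hind := (iIndepFun_pi (μ := fun _ : Fin n => μ)
      (X := fun _ d => covariate d j) fun _ => hX.aemeasurable).indepFun hii
    have hmi : ∀ i : Fin n, Measurable fun d : Fin n → FullData p => covariate (d i) j :=
      fun i => hX.comp (measurable_pi_apply i)
    have hlaw : ∀ i : Fin n, (Measure.pi fun _ : Fin n => μ).map (fun d => covariate (d i) j) =
        μ.map fun d => covariate d j := fun i => by
      have h := Measure.map_map (μ := Measure.pi fun _ : Fin n => μ) hX (measurable_pi_apply i)
      rw [show (fun d : Fin n → FullData p => d i) = Function.eval i from rfl,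
        (measurePreserving_eval (fun _ : Fin n => μ) i).map_eq] at h
      exact h.symm
    have hmap := (indepFun_iff_map_prod_eq_prod_map_map (hmi i).aemeasurable
      (hmi i').aemeasurable).1 hind
    rw [hlaw, hlaw] at hmap
    have hdiag : ((μ.map fun d => covariate d j).prod (μ.map fun d => covariate d j))
        {z | z.1 = z.2} = 0 := by
      rw [Measure.measure_prod_null (measurableSet_eq_fun measurable_fst measurable_snd)]
      refine ae_of_all _ fun x => ?_
      have : Prod.mk x ⁻¹' {z : ℝ × ℝ | z.1 = z.2} = {x} := by ext; simp [eq_comm]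
      exact (congrArg _ this).trans (hatom x)
    rw [← hmap, Measure.map_apply ((hmi i).prodMk (hmi i'))
      (measurableSet_eq_fun measurable_fst measurable_snd)] at hdiag
    exact measure_eq_zero_iff_ae_notMem.1 hdiag
  have hall : ∀ᵐ d ∂(Measure.pi fun _ : Fin n => μ), ∀ i i' : Fin n, i ≠ i' →
      covariate (d i) j ≠ covariate (d i') j := by
    simp only [ae_all_iff]
    exact hpair
  filter_upwards [hall] with d hd i i' h
  by_contra hne
  exact hd i i' hne h

theorem eventually_floor_mul_ne {x z : ℝ} (h : x ≠ z) :
    ∀ᶠ N : ℕ in atTop, ⌊(N : ℝ) * x⌋ ≠ ⌊(N : ℝ) * z⌋ := by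
  -- Equal floors force `N * |x - z| < 1`, which fails from this `M` on.
  obtain ⟨M, hM⟩ := exists_nat_gt (1 / |x - z|)
  filter_upwards [eventually_ge_atTop M] with N hN heq
  have h1 := Int.abs_sub_lt_one_of_floor_eq_floor heq
  have hpos : 0 < |x - z| := abs_pos.2 (sub_ne_zero.2 h)
  rw [← mul_sub, abs_mul, Nat.abs_cast] at h1
  have h2 : (1 : ℝ) < M * |x - z| := (div_lt_iff₀ hpos).1 hM
  have h3 : (M : ℝ) * |x - z| ≤ N * |x - z| :=
    mul_le_mul_of_nonneg_right (by exact_mod_cast hN) hpos.le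
  linarith

/-- Almost every sample has distinct coordinates, which a fine enough grid separates, so the
collision indicators tend to zero almost surely. -/
theorem tendsto_cell_collision {μ : Measure (FullData p)} [IsProbabilityMeasure μ] {j : Fin p}
    (hj : μ.map (fun d => covariate d j) ≪ volume) :
    Tendsto (fun N : ℕ => (Measure.pi fun _ : Fin n => μ)
      {d | ¬ Function.Injective fun i => cell N j (d i)}) atTop (𝓝 0) := by
  have h := tendsto_measure_of_ae_tendsto_indicator_of_isFiniteMeasure (L := atTop)
    (μ := Measure.pi fun _ : Fin n => μ) (A := ∅)
    (As := fun N : ℕ => {d | ¬ Function.Injective fun i => cell N j (d i)})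
    MeasurableSet.empty (fun N => measurableSet_cell_collision N j) ?_
  · simpa using h
  · filter_upwards [ae_coordinate_injective hj] with d hd
    have hev : ∀ᶠ N : ℕ in atTop, ∀ i i' : Fin n, i ≠ i' → cell N j (d i) ≠ cell N j (d i') := by
      simp only [eventually_all]
      intro i i' hii
      exact eventually_floor_mul_ne (hd.ne hii)
    filter_upwards [hev] with N hN
    refine iff_of_false (not_not.2 ?_) (Set.notMem_empty d)
    intro i i' h
    by_contra hne
    exact hN i i' hne h

end Coupling

/-! ### Samples with thresholded treatment -/

/-- The observed sample when unit `i` is treated iff `v i ≤ e (X i)`. -/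
noncomputable def thresholdSample (e : (Fin p → ℝ) → ℝ) (v : Fin n → ℝ) (d : Fin n → FullData p) :
    Fin n → ObsData p :=
  fun i => observeAs (decide (v i ≤ e (covariate (d i)))) (d i)

theorem measurable_thresholdSample {Ω : Type*} [MeasurableSpace Ω] {e : (Fin p → ℝ) → ℝ}
    (he : Measurable e) {v : Ω → Fin n → ℝ} (hv : Measurable v) {d : Ω → Fin n → FullData p}
    (hd : Measurable d) : Measurable fun ω => thresholdSample e (v ω) (d ω) := by
  refine measurable_pi_lambda _ fun i => ?_
  have hdi : Measurable fun ω => d ω i := (measurable_pi_apply i).comp hd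
  have hvi : Measurable fun ω => v ω i := (measurable_pi_apply i).comp hv
  exact measurable_observeAs_uncurry.comp
    ((measurable_decide_le hvi (he.comp (measurable_covariate.comp hdi))).prodMk hdi)

/-- The observed sample of a strongly ignorable law is a threshold sample with i.i.d. uniform
thresholds. -/
theorem lintegral_observe_eq_threshold {P : ProbabilityMeasure (FullData p)}
    (hP : CondIndepFun (sigmaX p) (sigmaX_le p) (fun d => (outcome1 d, outcome0 d)) treatment
      (P : Measure (FullData p)))
    {e : (Fin p → ℝ) → ℝ} (he : Measurable e) (hePx : propensity P = e ∘ covariate)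
    {φ : (Fin n → ObsData p) → ENNReal} (hφ : Measurable φ) :
    ∫⁻ o, φ o ∂(Measure.pi fun _ => (P : Measure (FullData p)).map observe) =
      ∫⁻ d, ∫⁻ v, φ (thresholdSample e v d) ∂(Measure.pi fun _ : Fin n => unifLaw)
        ∂(Measure.pi fun _ : Fin n => (P : Measure (FullData p))) := by
  have hdec : Measurable (fun z : FullData p × ℝ => decide (z.2 ≤ e (covariate z.1))) :=
    measurable_decide_le measurable_snd (he.comp (measurable_covariate.comp measurable_fst))
  have hre : Measurable (fun z : FullData p × ℝ =>
      reassign (decide (z.2 ≤ e (covariate z.1))) z.1) :=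
    measurable_reassign_uncurry.comp (hdec.prodMk measurable_fst)
  have hg : Measurable (fun z : FullData p × ℝ =>
      observeAs (decide (z.2 ≤ e (covariate z.1))) z.1) := measurable_observe.comp hre
  have hlaw : (P : Measure (FullData p)).map observe =
      ((P : Measure (FullData p)).prod unifLaw).map
        (fun z => observeAs (decide (z.2 ≤ e (covariate z.1))) z.1) := by
    conv_lhs => rw [← map_reassign_eq hP he hePx, Measure.map_map measurable_observe hre]
    rfl
  have : IsProbabilityMeasure (((P : Measure (FullData p)).prod unifLaw).map
        (fun z => observeAs (decide (z.2 ≤ e (covariate z.1))) z.1)) :=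
    Measure.isProbabilityMeasure_map hg.aemeasurable
  have hjoint : Measurable fun w : (Fin n → FullData p) × (Fin n → ℝ) =>
      φ (thresholdSample e w.2 w.1) :=
    hφ.comp (measurable_thresholdSample he measurable_snd measurable_fst)
  have hgn : Measurable fun (z : Fin n → FullData p × ℝ) i =>
      observeAs (decide ((z i).2 ≤ e (covariate (z i).1))) (z i).1 :=
    measurable_pi_lambda _ fun i => hg.comp (measurable_pi_apply i)
  rw [hlaw, ← Measure.pi_map_pi fun _ => hg.aemeasurable, lintegral_map hφ hgn,
    ← lintegral_prod _ hjoint.aemeasurable,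
    ← (measurePreserving_arrowProdEquivProdArrow (FullData p) ℝ (Fin n)
      (fun _ => (P : Measure (FullData p))) (fun _ => unifLaw)).lintegral_comp hjoint]
  rfl

theorem PredictionSet.condMissProb_le_one {S : Type*} [MeasurableSpace S] (C : PredictionSet p n S)
    (ν : Measure S) [IsProbabilityMeasure ν] (ρ : Measure (Fin p → ℝ)) [IsProbabilityMeasure ρ]
    (y : ℝ) (o : Fin n → ObsData p) : C.condMissProb ν ρ y o ≤ 1 := prob_le_one

/-! ### Comparison with strong overlap -/

section Comparison

variable {S : Type*} [MeasurableSpace S]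

/-- The arm selected at `x` by the thresholds `u` attached to the cells of width `1 / N`. -/
noncomputable def cellRule (e : (Fin p → ℝ) → ℝ) (N : ℕ) (j : Fin p) (u : ℤ → ℝ)
    (x : Fin p → ℝ) : Bool := decide (u ⌊(N : ℝ) * x j⌋ ≤ e x)

theorem measurable_eval_uncurry {ι : Type*} [Countable ι] [MeasurableSpace ι]
    [MeasurableSingletonClass ι] :
    Measurable fun z : (ι → ℝ) × ι => z.1 z.2 :=
  measurable_from_prod_countable_left fun i => measurable_pi_apply i

theorem measurable_cellRule {e : (Fin p → ℝ) → ℝ} (he : Measurable e) (N : ℕ) (j : Fin p)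
    (u : ℤ → ℝ) : Measurable (cellRule e N j u) := by
  have hx : Measurable fun x : Fin p → ℝ => (N : ℝ) * x j := (measurable_pi_apply j).const_mul _
  exact measurable_decide_le ((measurable_from_top (f := u)).comp (Int.measurable_floor.comp hx)) he

/-- For frozen `u`, the arm of each unit is a function of its own covariate, so the units stay
i.i.d. and the surrogate law for `cellRule` applies. Its sample law loses at most one factor `1 - c`
per unit. -/
theorem lintegral_thresholdSample_cell_le (C : PredictionSet p n S) (ν : Measure S)
    [IsProbabilityMeasure ν] {κ : Continuity} {P : ProbabilityMeasure (FullData p)}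
    (hP : P ∈ classE κ p) {e : (Fin p → ℝ) → ℝ} (he : Measurable e) (N : ℕ) (j : Fin p)
    (u : ℤ → ℝ) (y : ℝ) {c : ℝ} (hc₀ : 0 < c) (hc₁ : c ≤ 1 / 2) :
    ENNReal.ofReal (1 - c) ^ n *
      ∫⁻ d, C.condMissProb ν ((P : Measure (FullData p)).map covariate) y
        (thresholdSample e (fun i => u (cell N j (d i))) d)
        ∂(Measure.pi fun _ : Fin n => (P : Measure (FullData p))) ≤
      ⨆ Q ∈ classSIstr κ p, C.miscoverage ν Q := by
  have ha := measurable_cellRule he N j u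
  have hprob := isProbabilityMeasure_surrogateLaw (μ := (P : Measure (FullData p))) (y := y) ha
    hc₀.le (by linarith)
  let Q : ProbabilityMeasure (FullData p) :=
    ⟨surrogateLaw (P : Measure (FullData p)) (cellRule e N j u) y c, hprob⟩
  have hQ : (Q : Measure (FullData p)) = surrogateLaw P (cellRule e N j u) y c := rfl
  have hX : IsProbabilityMeasure ((P : Measure (FullData p)).map covariate) :=
    Measure.isProbabilityMeasure_map measurable_covariate.aemeasurable
  have hobsm : Measurable fun d : FullData p => observeAs (cellRule e N j u (covariate d)) d :=
    measurable_observeAs_uncurry.comp ((ha.comp measurable_covariate).prodMk measurable_id)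
  have hobs : IsProbabilityMeasure ((P : Measure (FullData p)).map
      fun d => observeAs (cellRule e N j u (covariate d)) d) :=
    Measure.isProbabilityMeasure_map hobsm.aemeasurable
  have hφ := C.measurable_condMissProb ν ((P : Measure (FullData p)).map covariate) y
  refine le_trans ?_ (le_iSup₂ Q (surrogateLaw_mem_classSIstr hP ha hc₀ hc₁ hQ))
  rw [C.miscoverage_eq_missProb ν Q y (ae_effect_surrogateLaw ha), C.missProb_eq_lintegral, hQ,
    map_covariate_surrogateLaw ha hc₀.le (by linarith)]
  have hle := smul_pi_le_pi (ι := Fin n)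
    (smul_map_observeAs_le (μ := (P : Measure (FullData p))) (y := y) (c := c) ha)
  refine le_trans (le_of_eq ?_) (lintegral_mono' hle le_rfl)
  have hobsn : Measurable fun (d : Fin n → FullData p) i =>
      observeAs (cellRule e N j u (covariate (d i))) (d i) :=
    measurable_pi_lambda _ fun i => hobsm.comp (measurable_pi_apply i)
  rw [lintegral_smul_measure, Fintype.card_fin, smul_eq_mul,
    ← Measure.pi_map_pi fun _ => hobsm.aemeasurable, lintegral_map hφ hobsn]
  rfl

theorem mul_missProb_le (C : PredictionSet p n S) (ν : Measure S) [IsProbabilityMeasure ν]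
    {κ : Continuity} {P : ProbabilityMeasure (FullData p)} (hP : P ∈ classSI κ p) (N : ℕ)
    (j : Fin p) (y : ℝ) {c : ℝ} (hc₀ : 0 < c) (hc₁ : c ≤ 1 / 2) :
    ENNReal.ofReal (1 - c) ^ n * C.missProb ν P y ≤
      (⨆ Q ∈ classSIstr κ p, C.miscoverage ν Q) +
        (Measure.pi fun _ : Fin n => (P : Measure (FullData p)))
          {d | ¬ Function.Injective fun i => cell N j (d i)} := by
  -- The propensity is measurable for `σ(X)`, hence factors through the covariate.
  obtain ⟨e, he, hePx⟩ : ∃ e : (Fin p → ℝ) → ℝ, Measurable e ∧ propensity P = e ∘ covariate :=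
    (stronglyMeasurable_condExp (m := sigmaX p)).measurable.exists_eq_measurable_comp
  have hX : IsProbabilityMeasure ((P : Measure (FullData p)).map covariate) :=
    Measure.isProbabilityMeasure_map measurable_covariate.aemeasurable
  set φ := C.condMissProb ν ((P : Measure (FullData p)).map covariate) y with hφdef
  have hφ : Measurable φ := C.measurable_condMissProb ν _ y
  set Pn := Measure.pi fun _ : Fin n => (P : Measure (FullData p)) with hPn
  set coll := {d : Fin n → FullData p | ¬ Function.Injective fun i => cell N j (d i)} with hcoll
  have hcollm : MeasurableSet coll := measurableSet_cell_collision N j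
  let unif := Measure.infinitePi fun _ : ℤ => unifLaw
  have hjoint : Measurable fun w : (ℤ → ℝ) × (Fin n → FullData p) =>
      φ (thresholdSample e (fun i => w.1 (cell N j (w.2 i))) w.2) := by
    refine hφ.comp (measurable_thresholdSample he (measurable_pi_lambda _ fun i => ?_)
      measurable_snd)
    exact measurable_eval_uncurry.comp (measurable_fst.prodMk
      ((measurable_cell N j).comp ((measurable_pi_apply i).comp measurable_snd)))
  have hjoint' : Measurable (Function.uncurry fun (d : Fin n → FullData p) (u : ℤ → ℝ) =>
      φ (thresholdSample e (fun i => u (cell N j (d i))) d)) := hjoint.comp measurable_swap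
  have hpt : ∀ d, ∫⁻ v, φ (thresholdSample e v d) ∂(Measure.pi fun _ : Fin n => unifLaw) ≤
      ∫⁻ u, φ (thresholdSample e (fun i => u (cell N j (d i))) d) ∂unif +
        coll.indicator 1 d := by
    intro d
    by_cases hd : d ∈ coll
    · rw [Set.indicator_of_mem hd]
      -- On a collision the thresholds are dependent, and the trivial bound by one is charged to the
      -- error term.
      refine le_trans (lintegral_mono fun v => C.condMissProb_le_one ν _ y _) ?_
      simp
    · have hinj : Function.Injective fun i => cell N j (d i) := not_not.1 hd
      rw [Set.indicator_of_notMem hd, add_zero, ← map_infinitePi_comp_injective unifLaw hinj,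
        lintegral_map]
      · exact hφ.comp (measurable_thresholdSample he measurable_id measurable_const)
      · exact measurable_pi_lambda _ fun i => measurable_pi_apply _
  have hswap : C.missProb ν P y ≤ ∫⁻ u, ∫⁻ d,
      φ (thresholdSample e (fun i => u (cell N j (d i))) d) ∂Pn ∂unif + Pn coll := by
    rw [C.missProb_eq_lintegral, lintegral_observe_eq_threshold hP.2 he hePx hφ]
    refine (lintegral_mono hpt).trans ?_
    rw [lintegral_add_right _ (measurable_one.indicator hcollm), lintegral_indicator_one hcollm]
    refine add_le_add (le_of_eq ?_) le_rfl
    -- Integrating over the sample first lets the bound for frozen `u` be used inside.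
    exact lintegral_lintegral_swap hjoint'.aemeasurable
  calc ENNReal.ofReal (1 - c) ^ n * C.missProb ν P y
      ≤ ENNReal.ofReal (1 - c) ^ n * (∫⁻ u, ∫⁻ d,
          φ (thresholdSample e (fun i => u (cell N j (d i))) d) ∂Pn ∂unif + Pn coll) := by gcongr
    _ = ∫⁻ u, ENNReal.ofReal (1 - c) ^ n * ∫⁻ d,
          φ (thresholdSample e (fun i => u (cell N j (d i))) d) ∂Pn ∂unif +
            ENNReal.ofReal (1 - c) ^ n * Pn coll := by
        rw [mul_add, lintegral_const_mul]
        exact hjoint.lintegral_prod_right'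
    _ ≤ ∫⁻ _, (⨆ Q ∈ classSIstr κ p, C.miscoverage ν Q) ∂unif + 1 * Pn coll := by
        gcongr with u
        · exact lintegral_thresholdSample_cell_le C ν hP.1 he N j u y hc₀ hc₁
        · exact pow_le_one₀ zero_le (ENNReal.ofReal_le_one.2 (by linarith))
    _ = _ := by simp [unif]

/-- Any fixed value is missed no more often than the effect can be under strong overlap. -/
theorem missProb_le_iSup_miscoverage (C : PredictionSet p n S) (ν : Measure S)
    [IsProbabilityMeasure ν] {κ : Continuity} {P : ProbabilityMeasure (FullData p)}
    (hP : P ∈ classSI κ p) (y : ℝ) :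
    C.missProb ν P y ≤ ⨆ Q ∈ classSIstr κ p, C.miscoverage ν Q := by
  obtain ⟨j, hj⟩ := hP.1.1
  have h1 : ∀ c : ℝ, 0 < c → c ≤ 1 / 2 →
      ENNReal.ofReal (1 - c) ^ n * C.missProb ν P y ≤ ⨆ Q ∈ classSIstr κ p, C.miscoverage ν Q := by
    intro c hc₀ hc₁
    have hlim := (tendsto_cell_collision (n := n) hj).const_add
      (⨆ Q ∈ classSIstr κ p, C.miscoverage ν Q)
    rw [add_zero] at hlim
    -- The grid is refined with `n` and `c` fixed; the supremum does not depend on `N`.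
    exact ge_of_tendsto' hlim fun N => mul_missProb_le C ν hP N j y hc₀ hc₁
  have hcont : Tendsto (fun c : ℝ => ENNReal.ofReal (1 - c) ^ n * C.missProb ν P y) (𝓝[>] 0)
      (𝓝 (1 * C.missProb ν P y)) := by
    have h2 : Tendsto (fun c : ℝ => ENNReal.ofReal (1 - c)) (𝓝[>] 0) (𝓝 1) := by
      have : Tendsto (fun c : ℝ => ENNReal.ofReal (1 - c)) (𝓝 0) (𝓝 (ENNReal.ofReal (1 - 0))) :=
        ENNReal.tendsto_ofReal (tendsto_const_nhds.sub tendsto_id)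
      simpa using this.mono_left nhdsWithin_le_nhds
    have h3 := ENNReal.Tendsto.pow (n := n) h2
    rw [one_pow] at h3
    exact ENNReal.Tendsto.mul_const h3 (Or.inl one_ne_zero)
  rw [one_mul] at hcont
  refine le_of_tendsto hcont ?_
  filter_upwards [Ioc_mem_nhdsGT (show (0 : ℝ) < 1 / 2 by norm_num)] with c hc
  exact h1 c hc.1 hc.2

/-- Tonelli: the expected length integrates the coverage probabilities of fixed values. -/
theorem PredictionSet.expectedLength_eq_lintegral (C : PredictionSet p n S) (ν : Measure S)
    [IsProbabilityMeasure ν] (P : ProbabilityMeasure (FullData p)) :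
    C.expectedLength ν P = ∫⁻ y : ℝ, (1 - C.missProb ν P y) := by
  have hprob : IsProbabilityMeasure (experiment n ν P) := by unfold experiment; infer_instance
  have hobs : Measurable (fun (d : Fin n → FullData p) i => observe (d i)) :=
    measurable_pi_lambda _ fun i => measurable_observe.comp (measurable_pi_apply i)
  have hmap : Measurable fun w : ((Fin n → FullData p) × S × FullData p) × ℝ =>
      ((fun i => observe (w.1.1 i), w.1.2.1, covariate w.1.2.2, w.2) :
        (Fin n → ObsData p) × S × (Fin p → ℝ) × ℝ) :=
    (hobs.comp (measurable_fst.comp measurable_fst)).prodMk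
      ((measurable_fst.comp (measurable_snd.comp measurable_fst)).prodMk
        ((measurable_covariate.comp
          (measurable_snd.comp (measurable_snd.comp measurable_fst))).prodMk measurable_snd))
  have hset : MeasurableSet {w : ((Fin n → FullData p) × S × FullData p) × ℝ |
      w.2 ∈ C.realized w.1} := hmap C.measurable_mem
  have h1 := Measure.prod_apply (μ := experiment n ν P) (ν := (volume : Measure ℝ)) hset
  rw [Measure.prod_apply_symm hset] at h1
  refine h1.symm.trans (lintegral_congr fun y => ?_)
  have hy : MeasurableSet {ω | y ∈ C.realized ω} := measurable_prodMk_right hset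
  have hcompl := measure_compl hy.compl (measure_ne_top (experiment n ν P) _)
  rw [compl_compl, measure_univ] at hcompl
  exact hcompl

/-- The coverage of every fixed value is at least `1 - r > 0`, and this constant has infinite
integral over the line. -/
theorem PredictionSet.expectedLength_eq_top (C : PredictionSet p n S) (ν : Measure S)
    [IsProbabilityMeasure ν] {P : ProbabilityMeasure (FullData p)} {r : ENNReal} (hr : r < 1)
    (h : ∀ y, C.missProb ν P y ≤ r) : C.expectedLength ν P = ⊤ := by
  rw [C.expectedLength_eq_lintegral, eq_top_iff]
  calc (⊤ : ENNReal) = ∫⁻ _ : ℝ, (1 - r) := by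
        rw [lintegral_const, Real.volume_univ, ENNReal.mul_top (tsub_pos_of_lt hr).ne']
    _ ≤ _ := lintegral_mono fun y => tsub_le_tsub_left (h y) 1

end Comparison

end ITE

theorem mainTheorem1 (κ : ITE.Continuity) (p : ℕ) (α : ℝ) (hα₀ : 0 ≤ α) (hα₁ : α < 1)
    {S : ℕ → Type*} [∀ n, MeasurableSpace (S n)]
    (ν : ∀ n, Measure (S n)) [∀ n, IsProbabilityMeasure (ν n)]
    (C : ∀ n, ITE.PredictionSet p n (S n))
    (hvalid : limsup (fun n => ⨆ P ∈ ITE.classSIstr κ p, (C n).miscoverage (ν n) P) atTop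
      ≤ ENNReal.ofReal α) :
    ∀ P ∈ ITE.classSI κ p,
      (∀ y : ℝ, limsup (fun n => (C n).missProb (ν n) P y) atTop ≤ ENNReal.ofReal α) ∧
      Tendsto (fun n => (C n).expectedLength (ν n) P) atTop (𝓝 ⊤) := by
  intro P hP
  have hle : ∀ n y, (C n).missProb (ν n) P y ≤
      ⨆ Q ∈ ITE.classSIstr κ p, (C n).miscoverage (ν n) Q :=
    fun n y => ITE.missProb_le_iSup_miscoverage (C n) (ν n) hP y
  refine ⟨fun y => (limsup_le_limsup (Eventually.of_forall fun n => hle n y)).trans hvalid, ?_⟩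
  have hlt : limsup (fun n => ⨆ Q ∈ ITE.classSIstr κ p, (C n).miscoverage (ν n) Q) atTop < 1 :=
    hvalid.trans_lt (by simpa using hα₁)
  -- The expected length is not merely divergent: it equals `⊤` as soon as the worst miscoverage is
  -- below one.
  refine tendsto_const_nhds.congr' ?_
  filter_upwards [eventually_lt_of_limsup_lt hlt] with n hn
  exact ((C n).expectedLength_eq_top (ν n) hn (hle n)).symm
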